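/- **Theorem.** Let $k$ be either $\mathbb{R}$ with its usual absolute value, or a non-Archimedean local field with an absolute value $|\cdot|$ defining its topology such that $\lambda_k(\{|x|\le |a|\})\le |a|\,\lambda_k(\{|x|\le 1\})$ for all $a\in k$ with $|a|\le 1$, where $\lambda_k$ is Haar measure on $k$ (for the normalized absolute value this holds with equality). Let $M$ be a compact $k$-analytic manifold of dimension $d=\dim_k M\ge 1$. Let $\eta$ be a Borel probability measure in the canonical measure class of $M$ (in every chart it has the same null sets as Haar measure on $k^d$) whose densities with respect to Haar measure in charts are locally bounded; for example, normalized Haar measure if $M$ is a compact $k$-analytic group. Let $m$ be a non-negative integer and equip $k^m$ with $\|(x_1,\dots,x_m)\|_\infty=\max_i|x_i|$. Let $\mathcal{A}(M,k^m)$ be the $k$-vector space of $k$-analytic maps $f:M\to k^m$, with the topology of the norm $\|f\|_M=\sup_{x\in M}\|f(x)\|_\infty$. For $k$-analytic $f:M\to k$ and $p\in M$, choose a chart $\varphi$ with $\varphi(p)=0$, write $f\circ\varphi^{-1}(x)=\sum_\beta c_\beta x^\beta$ near $0$ (a sum over multi-indices), and put $\mathrm{ord}_p f=\inf\{|\beta|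 : c_\beta\ne 0\}\in\{0,1,2,\dots\}\cup\{\infty\}$, with $\mathrm{ord}_pf=\infty$ if all $c_\beta$ vanish; this does not depend on $\varphi$. For $f=(f_1,\dots,f_m)$ put $\mathrm{ord}_p f=\inf_i \mathrm{ord}_p f_i$, and for a family $\mathcal{F}\subset\mathcal{A}(M,k^m)$ put $\mathrm{ord}_M\mathcal{F}=\sup_{p\in M}\sup_{f\in\mathcal{F}}\mathrm{ord}_p f$. Let $\mathcal{F}\subset \mathcal{A}(M,k^m)$ be compact with $\dim_k\mathrm{span}_k\mathcal{F}<\infty$. Then there are constants $\kappa_{\mathcal F},\varepsilon_{\mathcal F}>0$ such that every $f\in\mathcal{F}$ satisfies $$\eta(\{x\in M : \|f(x)\|_\infty<\varepsilon\})\le \kappa_{\mathcal F}\,\varepsilon^{\frac{1}{\dim_k M\cdot \mathrm{ord}_M\mathcal{F}}}\qquad \text{for all } 0<\varepsilon<\varepsilon_{\mathcal F}.$$ Here $1/\infty=0$ and $1/0=\infty$, with $\varepsilon^0=1$ and $\varepsilon^\infty=0$ for $0<\varepsilon<1$. -/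

import Mathlib

open Set Filter Topology MeasureTheory
open scoped Manifold ContDiff ENNReal NNReal

/-- The ground field: `k` is the field of real numbers with its usual absolute value, or a
non-Archimedean local field whose absolute value satisfies
`vol {x : |x| ≤ |a|} ≤ |a| * vol {x : |x| ≤ 1}` whenever `|a| ≤ 1`. The last condition holds with
equality for the normalized absolute value (the module of `k`); it also holds for every power
with exponent in `(0, 1]` of the normalized one, for example for the absolute value of a finite
extension of the `p`-adic numbers that extends the `p`-adic one.
Local compactness is the class `ProperSpace k`. -/
def IsRealOrNonarchimedean (k : Type*) [NontriviallyNormedField k] [ProperSpace k]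
    [MeasurableSpace k] [BorelSpace k] : Prop :=
  (∃ e : k ≃+* ℝ, ∀ x : k, |e x| = ‖x‖) ∨
  (IsUltrametricDist k ∧
    ∀ a : k, ‖a‖ ≤ 1 →
      (Measure.addHaar : Measure k) (Metric.closedBall 0 ‖a‖) ≤
        ENNReal.ofReal ‖a‖ * (Measure.addHaar : Measure k) (Metric.closedBall 0 1))

/-- The `k`-vector space `𝒜(M, k^m)` of `k`-analytic maps `M → k^m` on a compact manifold `M`, with
the topology given by the norm `f ↦ sup_{x ∈ M} ‖f x‖_∞` (the norm of `C(M, k^m)`; the norm of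
`Fin m → k` is the supremum norm). -/
def analyticMaps (k : Type*) [NontriviallyNormedField k] (d m : ℕ)
    (M : Type*) [TopologicalSpace M] [ChartedSpace (Fin d → k) M] :
    Submodule k C(M, Fin m → k) where
  carrier := {f | ContMDiff 𝓘(k, Fin d → k) 𝓘(k, Fin m → k) ω (f : M → (Fin m → k))}
  add_mem' hf hg := hf.add hg
  zero_mem' := contMDiff_const
  smul_mem' c _ hf := (contMDiff_const (I' := 𝓘(k, k)) (c := c)).smul hf

section Order

variable {k : Type*} [NontriviallyNormedField k] {d m : ℕ}

/-- `g (a + x) = ∑_β c_β x^β` for all `x` in a neighbourhood of `0` in `k^d`. -/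
def HasPowerSeriesExpansionAt (g : (Fin d → k) → k) (a : Fin d → k)
    (c : MvPowerSeries (Fin d) k) : Prop :=
  ∀ᶠ x : Fin d → k in 𝓝 0,
    HasSum (fun β : Fin d →₀ ℕ => MvPowerSeries.coeff β c * ∏ i, x i ^ β i) (g (a + x))

/-- The order at `a` of a function on `k^d` analytic at `a`: the least `|β|` with `c_β ≠ 0` in its
power series expansion at `a`, and `∞` if all `c_β` vanish. The expansion is unique, so the outer
infimum is over one power series. -/
noncomputable def orderAt (g : (Fin d → k) → k) (a : Fin d → k) : ℕ∞ :=
  ⨅ (c : MvPowerSeries (Fin d) k) (_ : HasPowerSeriesExpansionAt g a c), c.order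

variable {M : Type*} [TopologicalSpace M] [ChartedSpace (Fin d → k) M]

/-- `ord_p f` for a `k`-valued function `f` on `M`, computed in the preferred chart at `p`. -/
noncomputable def scalarOrd (f : M → k) (p : M) : ℕ∞ :=
  orderAt (f ∘ (chartAt (Fin d → k) p).symm) (chartAt (Fin d → k) p p)

/-- `ord_p f = inf_i ord_p f_i` for `f = (f_1, …, f_m)`. -/
noncomputable def mapOrd (f : M → (Fin m → k)) (p : M) : ℕ∞ :=
  ⨅ i : Fin m, scalarOrd (d := d) (fun x => f x i) p

/-- `ord_M 𝓕 = sup_{p ∈ M} sup_{f ∈ 𝓕} ord_p f`. -/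
noncomputable def familyOrd (F : Set (analyticMaps k d m M)) : ℕ∞ :=
  ⨆ p : M, ⨆ f ∈ F, mapOrd (d := d) (f : C(M, Fin m → k)) p

end Order

section MeasureClass

variable (k : Type*) [NontriviallyNormedField k] [ProperSpace k] [MeasurableSpace k] [BorelSpace k]
  (d : ℕ) {M : Type*} [TopologicalSpace M] [ChartedSpace (Fin d → k) M] [MeasurableSpace M]

/-- `η` belongs to the canonical measure class of `M`: in every chart of the atlas it has the same
null sets as Haar measure on `k^d`. -/
def InCanonicalMeasureClass (η : Measure M) : Prop :=
  ∀ e ∈ atlas (Fin d → k) M, ∀ s ⊆ e.source,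
    (η s = 0 ↔ (Measure.addHaar : Measure (Fin d → k)) (e '' s) = 0)

/-- In every chart, the density of `η` with respect to Haar measure on `k^d` is locally bounded. -/
def HasLocallyBoundedDensity (η : Measure M) : Prop :=
  ∀ e ∈ atlas (Fin d → k) M, ∀ x ∈ e.source, ∃ U ∈ 𝓝 x, U ⊆ e.source ∧ ∃ D : ℝ≥0,
    ∀ s ⊆ U, MeasurableSet s →
      η s ≤ (D : ℝ≥0∞) * (Measure.addHaar : Measure (Fin d → k)) (e '' s)

end MeasureClass

/-- `ε ^ a` for a real `ε > 0` and an exponent `a ∈ [0, ∞]`, with the usual limiting values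
for `a = ∞`; in particular `ε ^ ∞ = 0` if `0 < ε < 1`. -/
noncomputable def extendedPow (ε : ℝ) (a : ℝ≥0∞) : ℝ≥0∞ :=
  if a = ⊤ then (if ε < 1 then 0 else if ε = 1 then 1 else ⊤) else ENNReal.ofReal (ε ^ a.toReal)

/-! Divided differences play the role of derivatives, which makes one argument work over every
admissible field: no mean value theorem is needed and no factorial has to be inverted. Near `p` and
`f₀`, some component has order `r ≤ ord_M 𝓕`, and some line through `p` in a chart sees this order.
Along nearby parallel lines, the divided differences of order `r` stay close to the `r`-th
coefficient on that line. Hence they are bounded below, uniformly for `f` near `f₀` in the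
finite-dimensional span (`exists_le_norm_dividedDifference`).

If `‖G‖ < ε` at `r + 1` points with mutual distances at least `δ`, the divided difference is at most
`(r + 1) ε / δ ^ r`. For `δ` of size `ε ^ (1 / N)`, `N ≥ r`, this contradicts the lower bound, so on
each line the sublevel set lies in `r` balls of radius `δ`
(`measure_sublevel_le_of_dividedDifference`). Fubini (`addHaar_mul_le_of_slices`) and the density
bound give a local estimate on `M`, and compactness of `𝓕 × M` makes it global. Only `r ≤ N`
matters, so `N = d * ord_M 𝓕` is admissible. -/

/-! ### Divided differences of powers and of power series -/

section DividedDifference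

open scoped Classical in
/-- The divided difference of `g` at the points of `s`. -/
noncomputable def dividedDifference {K : Type*} [Field K] (s : Finset K) (g : K → K) : K :=
  ∑ t ∈ s, (∏ u ∈ s.erase t, (t - u))⁻¹ * g t

variable {K : Type*} [Field K]

open scoped Classical in
-- The factor `t - a` kills the term at `a` and cancels against the denominator elsewhere. All
-- evaluations on powers below come from this identity by induction.
theorem dividedDifference_sub_mul {s : Finset K} {a : K} (ha : a ∈ s) (g : K → K) :
    dividedDifference s (fun t => (t - a) * g t) = dividedDifference (s.erase a) g := by
  unfold dividedDifference
  rw [← Finset.sum_erase s (a := a) (by simp)]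
  refine Finset.sum_congr rfl fun t ht => ?_
  have hta : t ≠ a := Finset.ne_of_mem_erase ht
  have h0 : t - a ≠ 0 := sub_ne_zero.2 hta
  rw [← Finset.mul_prod_erase (s.erase t) (fun u => t - u)
    (Finset.mem_erase.2 ⟨hta.symm, ha⟩), Finset.erase_right_comm, mul_inv]
  field_simp

theorem dividedDifference_add (s : Finset K) (f g : K → K) :
    dividedDifference s (fun t => f t + g t) = dividedDifference s f + dividedDifference s g := by
  simp only [dividedDifference, mul_add, Finset.sum_add_distrib]

theorem dividedDifference_const_mul (s : Finset K) (c : K) (g : K → K) :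
    dividedDifference s (fun t => c * g t) = c * dividedDifference s g := by
  simp only [dividedDifference, Finset.mul_sum]
  exact Finset.sum_congr rfl fun t _ => by ring

theorem dividedDifference_sum {ι : Type*} (J : Finset ι) (s : Finset K) (g : ι → K → K) :
    dividedDifference s (fun t => ∑ j ∈ J, g j t) = ∑ j ∈ J, dividedDifference s (g j) := by
  simp only [dividedDifference, Finset.mul_sum]
  exact Finset.sum_comm

theorem dividedDifference_one {s : Finset K} (hs : 2 ≤ s.card) :
    dividedDifference s (fun _ => 1) = 0 := by
  classical
  induction hn : s.card using Nat.strong_induction_on generalizing s with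
  | _ n ih =>
    obtain ⟨a, ha, b, hb, hab⟩ := Finset.one_lt_card.1 (show 1 < s.card by omega)
    have e1 := dividedDifference_sub_mul ha (fun _ => (1 : K))
    have e2 := dividedDifference_sub_mul hb (fun _ => (1 : K))
    -- The functions `t - a` and `t - b` differ by a nonzero constant, so it suffices that erasing
    -- `a` or `b` gives the same value: `0` by induction, or `1` on a singleton.
    have e3 : dividedDifference s (fun t => (t - a) * 1) =
        dividedDifference s (fun t => (t - b) * 1) +
          (b - a) * dividedDifference s (fun _ => 1) := by
      rw [← dividedDifference_const_mul, ← dividedDifference_add]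
      congr 1; ext t; ring
    have e4 : dividedDifference (s.erase a) (fun _ => (1 : K)) =
        dividedDifference (s.erase b) (fun _ => 1) := by
      have ca := Finset.card_erase_of_mem ha
      have cb := Finset.card_erase_of_mem hb
      rcases Nat.lt_or_ge 2 s.card with h | h
      · rw [ih _ (by omega) (by omega) ca, ih _ (by omega) (by omega) cb]
      · obtain ⟨x, hx⟩ := Finset.card_eq_one.1 (show (s.erase a).card = 1 by omega)
        obtain ⟨y, hy⟩ := Finset.card_eq_one.1 (show (s.erase b).card = 1 by omega)
        simp [dividedDifference, hx, hy]
    rw [e1, e2, e4] at e3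
    have : (b - a) * dividedDifference s (fun _ => (1 : K)) = 0 := by
      simpa using e3
    exact (mul_eq_zero.1 this).resolve_left (sub_ne_zero.2 hab.symm)

open scoped Classical in
theorem dividedDifference_pow_succ {s : Finset K} {a : K} (ha : a ∈ s) (n : ℕ) :
    dividedDifference s (fun t => t ^ (n + 1)) =
      a * dividedDifference s (fun t => t ^ n) +
        dividedDifference (s.erase a) (fun t => t ^ n) := by
  rw [← dividedDifference_sub_mul ha, ← dividedDifference_const_mul, ← dividedDifference_add]
  congr 1; ext t; ring

theorem dividedDifference_pow_eq_zero {s : Finset K} {n : ℕ} (hs : n + 1 < s.card) :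
    dividedDifference s (fun t => t ^ n) = 0 := by
  classical
  induction n generalizing s with
  | zero => simpa using dividedDifference_one (s := s) (by omega)
  | succ n ih =>
    obtain ⟨a, ha⟩ := Finset.card_pos.1 (show 0 < s.card by omega)
    have := Finset.card_erase_of_mem ha
    rw [dividedDifference_pow_succ ha, ih (by omega), ih (by omega)]
    simp

theorem dividedDifference_pow_eq_one {s : Finset K} {n : ℕ} (hs : s.card = n + 1) :
    dividedDifference s (fun t => t ^ n) = 1 := by
  classical
  induction n generalizing s with
  | zero =>
    obtain ⟨x, rfl⟩ := Finset.card_eq_one.1 hs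
    simp [dividedDifference]
  | succ n ih =>
    obtain ⟨a, ha⟩ := Finset.card_pos.1 (show 0 < s.card by omega)
    have := Finset.card_erase_of_mem ha
    rw [dividedDifference_pow_succ ha, dividedDifference_pow_eq_zero (s := s) (by omega),
      ih (by omega)]
    simp

variable {k : Type*} [NontriviallyNormedField k]

/-- The divided difference of `t ^ n` is the complete homogeneous polynomial of degree `n - r` in
the `r + 1` points; it has at most `2 ^ n` monomials. The factor `ρ ^ r` on the left avoids the
subtraction `n - r`. The bound does not degrade when points come close together. -/
theorem norm_dividedDifference_pow_mul_le {s : Finset k} {r : ℕ} (hs : s.card = r + 1) {ρ : ℝ}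
    (hρ : 0 ≤ ρ) (h : ∀ t ∈ s, ‖t‖ ≤ ρ) (n : ℕ) :
    ‖dividedDifference s (fun t => t ^ n)‖ * ρ ^ r ≤ (2 * ρ) ^ n := by
  classical
  induction n generalizing s r with
  | zero =>
    rcases Nat.eq_zero_or_pos r with rfl | hr
    · rw [dividedDifference_pow_eq_one hs]; simp
    · rw [dividedDifference_pow_eq_zero (by omega)]; simp
  | succ n ih =>
    obtain ⟨a, ha⟩ := Finset.card_pos.1 (show 0 < s.card by omega)
    have hc := Finset.card_erase_of_mem ha
    rw [dividedDifference_pow_succ ha]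
    have h1 : ‖a * dividedDifference s (fun t => t ^ n)‖ * ρ ^ r ≤ ρ * (2 * ρ) ^ n := by
      rw [norm_mul, mul_assoc]
      exact mul_le_mul (h a ha) (ih hs h) (by positivity) hρ
    have h2 : ‖dividedDifference (s.erase a) (fun t => t ^ n)‖ * ρ ^ r ≤ ρ * (2 * ρ) ^ n := by
      rcases r with _ | r
      · have : s.erase a = ∅ := Finset.card_eq_zero.1 (by omega)
        rw [this]
        simp only [dividedDifference, Finset.sum_empty, norm_zero, zero_mul]
        positivity
      · have := ih (s := s.erase a) (r := r) (by omega)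
          (fun t ht => h t (Finset.mem_of_mem_erase ht))
        calc _ = ρ * (‖dividedDifference (s.erase a) (fun t => t ^ n)‖ * ρ ^ r) := by ring
          _ ≤ _ := by gcongr
    calc _ ≤ (‖a * dividedDifference s (fun t => t ^ n)‖ +
          ‖dividedDifference (s.erase a) (fun t => t ^ n)‖) * ρ ^ r := by
            gcongr; exact norm_add_le _ _
      _ ≤ ρ * (2 * ρ) ^ n + ρ * (2 * ρ) ^ n := by rw [add_mul]; exact add_le_add h1 h2
      _ = _ := by ring

/-- Near `0`, the divided differences of order `r` of a power series are close to its `r`-th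
coefficient. -/
theorem norm_dividedDifference_sub_coeff_le {s : Finset k} {r : ℕ} (hs : s.card = r + 1)
    {ρ ρ₀ C : ℝ} (hρ : 0 < ρ) (hρ₀ : 4 * ρ ≤ ρ₀) (h : ∀ t ∈ s, ‖t‖ ≤ ρ)
    {G : k → k} {c : ℕ → k} (hc : ∀ n, ‖c n‖ * ρ₀ ^ n ≤ C)
    (hG : ∀ t ∈ s, HasSum (fun n => c n * t ^ n) (G t)) :
    ‖dividedDifference s G - c r‖ ≤ C * (2 / ρ₀) ^ (r + 1) * 2 * ρ := by
  classical
  have hρ₀' : 0 < ρ₀ := by linarith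
  have hC : 0 ≤ C := le_trans (by positivity) (hc 0)
  have h1 : HasSum (fun n => c n * dividedDifference s (fun t => t ^ n))
      (dividedDifference s G) := by
    have : HasSum (fun n => ∑ t ∈ s, (∏ u ∈ s.erase t, (t - u))⁻¹ * (c n * t ^ n))
        (dividedDifference s G) := hasSum_sum fun t ht => (hG t ht).mul_left _
    convert this using 2 with n
    simp only [dividedDifference, Finset.mul_sum]
    exact Finset.sum_congr rfl fun t _ => by ring
  -- The first `r + 1` terms contribute exactly `c r`: powers below `r` are annihilated and `t ^ r`
  -- gives `1`. Only the tail needs a bound.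
  have h2 := (hasSum_nat_add_iff' (r + 1)).2 h1
  rw [Finset.sum_range_succ, dividedDifference_pow_eq_one hs, Finset.sum_eq_zero, zero_add,
    mul_one] at h2
  · have hb : ∀ n, ‖c (n + (r + 1)) * dividedDifference s (fun t => t ^ (n + (r + 1)))‖ ≤
        C * (2 / ρ₀) ^ (r + 1) * ρ * (1 / 2) ^ n := by
      intro n
      have e1 := norm_dividedDifference_pow_mul_le hs hρ.le h (n + (r + 1))
      have e2 : ‖dividedDifference s (fun t => t ^ (n + (r + 1)))‖ ≤
          2 ^ (n + (r + 1)) * ρ ^ (n + 1) := by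
        refine le_of_mul_le_mul_right (e1.trans_eq ?_) (pow_pos hρ r)
        ring
      have e3 : ‖c (n + (r + 1))‖ ≤ C / ρ₀ ^ (n + (r + 1)) := by
        rw [le_div_iff₀ (by positivity)]; exact hc _
      rw [norm_mul]
      calc _ ≤ C / ρ₀ ^ (n + (r + 1)) * (2 ^ (n + (r + 1)) * ρ ^ (n + 1)) := by gcongr
        _ = C * (2 / ρ₀) ^ (r + 1) * ρ * (2 * ρ / ρ₀) ^ n := by
          simp only [div_pow, mul_pow, pow_add, pow_one]
          field_simp
        _ ≤ _ := by
          have : 2 * ρ / ρ₀ ≤ 1 / 2 := by rw [div_le_iff₀ hρ₀']; linarith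
          gcongr
    have hg : HasSum (fun n : ℕ => C * (2 / ρ₀) ^ (r + 1) * ρ * (1 / 2 : ℝ) ^ n)
        (C * (2 / ρ₀) ^ (r + 1) * ρ * 2) := hasSum_geometric_two.mul_left _
    rw [← h2.tsum_eq]
    exact (tsum_of_norm_bounded hg hb).trans_eq (by ring)
  · intro n hn
    rw [dividedDifference_pow_eq_zero (by rw [hs]; simpa using hn), mul_zero]

/-- Each of the `r + 1` summands has a denominator of norm at least `δ ^ r`. -/
theorem norm_dividedDifference_mul_le {s : Finset k} {r : ℕ} (hs : s.card = r + 1) {δ ε : ℝ}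
    (hδ : 0 < δ) (hsep : ∀ t ∈ s, ∀ u ∈ s, t ≠ u → δ ≤ dist t u) {G : k → k}
    (hG : ∀ t ∈ s, ‖G t‖ ≤ ε) :
    ‖dividedDifference s G‖ * δ ^ r ≤ (r + 1) * ε := by
  classical
  have : ‖dividedDifference s G‖ ≤ ∑ _t ∈ s, ε / δ ^ r := by
    refine norm_sum_le_of_le _ fun t ht => ?_
    have hp : δ ^ r ≤ ∏ u ∈ s.erase t, ‖t - u‖ := by
      have : (s.erase t).card = r := by rw [Finset.card_erase_of_mem ht]; omega
      rw [← this, ← Finset.prod_const]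
      refine Finset.prod_le_prod (fun _ _ => hδ.le) fun u hu => ?_
      rw [← dist_eq_norm]
      exact hsep t ht u (Finset.mem_of_mem_erase hu) (Finset.ne_of_mem_erase hu).symm
    rw [norm_mul, norm_inv, norm_prod, mul_comm, ← div_eq_mul_inv]
    have := (norm_nonneg _).trans (hG t ht)
    exact div_le_div₀ this (hG t ht) (by positivity) hp
  rw [Finset.sum_const, hs, nsmul_eq_mul] at this
  calc _ ≤ ((r + 1 : ℕ) * (ε / δ ^ r)) * δ ^ r := by gcongr
    _ = _ := by field_simp; push_cast; ring

end DividedDifference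

/-! ### Separation or covering -/

/-- A set without `n + 1` points at pairwise distance larger than `δ` is covered by `n` balls. -/
theorem exists_separated_or_covered {X : Type*} [PseudoMetricSpace X] (A : Set X) {δ : ℝ}
    (hδ : 0 ≤ δ) (n : ℕ) :
    (∃ s : Finset X, ↑s ⊆ A ∧ s.card = n + 1 ∧ ∀ t ∈ s, ∀ u ∈ s, t ≠ u → δ < dist t u) ∨
    (∃ s : Finset X, s.card ≤ n ∧ A ⊆ ⋃ t ∈ s, Metric.closedBall t δ) := by
  classical
  induction n with
  | zero =>
    rcases A.eq_empty_or_nonempty with rfl | ⟨x, hx⟩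
    · exact .inr ⟨∅, by simp⟩
    · exact .inl ⟨{x}, by simpa using hx, by simp, by simp⟩
  | succ n ih =>
    rcases ih with ⟨s, hsA, hc, hs⟩ | ⟨s, hc, hs⟩
    · by_cases h : A ⊆ ⋃ t ∈ s, Metric.closedBall t δ
      · exact .inr ⟨s, hc.le, h⟩
      · obtain ⟨x, hxA, hx⟩ := Set.not_subset.1 h
        simp only [mem_iUnion, Metric.mem_closedBall, not_exists, not_le] at hx
        have hxs : x ∉ s := fun hxs => absurd (hx x hxs) (by simpa using hδ)
        refine .inl ⟨insert x s, ?_, by rw [Finset.card_insert_of_notMem hxs, hc], ?_⟩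
        · rw [Finset.coe_insert]; exact insert_subset hxA hsA
        · intro t ht u hu htu
          rw [Finset.mem_insert] at ht hu
          rcases ht with rfl | ht
          · exact hx u (hu.resolve_left htu.symm)
          · rcases hu with rfl | hu
            · rw [dist_comm]; exact hx t ht
            · exact hs t ht u hu htu
    · exact .inr ⟨s, hc.trans n.le_succ, hs⟩

/-! ### Taylor coefficients along lines -/

section DirectionalCoefficient

variable {k : Type*} [NontriviallyNormedField k]

/-- Cauchy estimates uniform in the centre: the double series that dominates every re-centred series
depends only on `r`, and each inner sum is at most the total. -/
theorem FormalMultilinearSeries.exists_norm_changeOrigin_mul_pow_le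
    {E F : Type*} [NormedAddCommGroup E] [NormedSpace k E] [NormedAddCommGroup F] [NormedSpace k F]
    (p : FormalMultilinearSeries k E F) {r : ℝ≥0} (hr : (r + r : ℝ≥0∞) < p.radius) :
    ∃ C : ℝ, ∀ x : E, ‖x‖ ≤ r → ∀ n, ‖p.changeOrigin x n‖ * (r : ℝ) ^ n ≤ C := by
  have hs := p.changeOriginSeries_summable_aux₁ hr
  have hsum := (NNReal.summable_sigma.1 hs).2
  refine ⟨((∑' n : ℕ, ∑' s : Σ l : ℕ, { s : Finset (Fin (n + l)) // s.card = l },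
    ‖p (n + s.1)‖₊ * r ^ s.1 * r ^ n : ℝ≥0) : ℝ), fun x hx n => ?_⟩
  have hx' : ‖x‖₊ ≤ r := hx
  have hrr : (r : ℝ≥0∞) < p.radius := (le_add_right le_rfl).trans_lt hr
  have hxr : (‖x‖₊ : ℝ≥0∞) < p.radius := lt_of_le_of_lt (by exact_mod_cast hx') hrr
  have h1 : ‖p.changeOrigin x n‖₊ * r ^ n ≤
      ∑' s : Σ l : ℕ, { s : Finset (Fin (n + l)) // s.card = l },
        ‖p (n + s.1)‖₊ * r ^ s.1 * r ^ n := by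
    rw [NNReal.tsum_mul_right]
    gcongr
    refine (p.nnnorm_changeOrigin_le n hxr).trans ?_
    refine Summable.tsum_le_tsum (fun s => by gcongr) (p.changeOriginSeries_summable_aux₂ hxr n)
      (p.changeOriginSeries_summable_aux₂ hrr n)
  exact_mod_cast h1.trans (hsum.le_tsum n fun _ _ => zero_le)

/-- The divided differences of order `r` of `φ` in direction `v`, along lines and at points near
`a`, tend to `ℓ`. -/
def HasDirectionalCoeff {E : Type*} [NormedAddCommGroup E] [NormedSpace k E] (φ : E → k) (a v : E)
    (r : ℕ) (ℓ : k) : Prop :=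
  ∀ τ : ℝ, 0 < τ → ∀ᶠ ρ : ℝ in 𝓝[>] 0, ∀ x : E, ‖x‖ ≤ ρ → ∀ s : Finset k, s.card = r + 1 →
    (∀ t ∈ s, ‖t‖ ≤ ρ) → ‖dividedDifference s (fun t => φ (a + x + t • v)) - ℓ‖ ≤ τ

/-- Re-centring the series at `a + x` gives coefficients along `v` that obey a common Cauchy bound
and whose `r`-th member is continuous in `x`. The bound controls the divided differences, and
continuity moves the coefficient back to `x = 0`. -/
theorem HasFPowerSeriesAt.hasDirectionalCoeff [CompleteSpace k]
    {E : Type*} [NormedAddCommGroup E] [NormedSpace k E]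
    {φ : E → k} {a : E} (hφ : AnalyticAt k φ a) {v : E} {q : FormalMultilinearSeries k k k}
    (hq : HasFPowerSeriesAt (fun t : k => φ (a + t • v)) q 0) (r : ℕ) :
    HasDirectionalCoeff φ a v r (q.coeff r) := by
  obtain ⟨p, R, hp⟩ := hφ
  obtain ⟨ρ₀, hρ₀, hρR⟩ : ∃ ρ₀ : ℝ≥0, 0 < ρ₀ ∧ (ρ₀ + ρ₀ : ℝ≥0∞) < R := by
    obtain ⟨c, hc0, hc⟩ := ENNReal.lt_iff_exists_nnreal_btwn.1 hp.r_pos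
    refine ⟨c / 2, half_pos (by exact_mod_cast hc0), ?_⟩
    rw [← ENNReal.coe_add, add_halves]; exact hc
  obtain ⟨C, hC⟩ := p.exists_norm_changeOrigin_mul_pow_le (hρR.trans_le hp.r_le)
  set c : E → ℕ → k := fun x n => p.changeOrigin x n (fun _ => v) with hc
  have hsum : ∀ x : E, ‖x‖ ≤ ρ₀ → ∀ t : k, ‖t • v‖ ≤ ρ₀ →
      HasSum (fun n => c x n * t ^ n) (φ (a + x + t • v)) := by
    intro x hx t ht
    have hx' : ‖x‖ₑ ≤ ρ₀ := by exact_mod_cast (show ‖x‖₊ ≤ ρ₀ from hx)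
    have ht' : ‖t • v‖ₑ ≤ ρ₀ := by exact_mod_cast (show ‖t • v‖₊ ≤ ρ₀ from ht)
    have h1 := hp.changeOrigin (y := x) (hx'.trans_lt ((le_add_right le_rfl).trans_lt hρR))
    have h2 : t • v ∈ Metric.eball (0 : E) (R - ‖x‖ₑ) := by
      rw [mem_eball_zero_iff, lt_tsub_iff_right]
      exact (add_le_add ht' hx').trans_lt hρR
    refine (h1.hasSum h2).congr_fun fun n => ?_
    rw [(p.changeOrigin x n).map_smul_univ (fun _ => t) (fun _ => v)]
    simp [hc, mul_comm]
  have hcont : ContinuousAt (fun x => c x r) 0 := by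
    have := (p.analyticAt_changeOrigin (hp.r_pos.trans_le hp.r_le) r).continuousAt
    exact ((ContinuousMultilinearMap.apply k (fun _ : Fin r => E) k
      (fun _ => v)).continuous.continuousAt).comp this
  -- Scaled so that `‖t‖ ≤ ρ₁` forces `‖t • v‖ ≤ ρ₀`; the `1 +` also covers `v = 0`.
  set ρ₁ : ℝ := ρ₀ / (1 + ‖v‖) with hρ₁
  have hv : 0 < 1 + ‖v‖ := by positivity
  have hρ₀' : (0 : ℝ) < ρ₀ := hρ₀
  have hρ₁0 : 0 < ρ₁ := by positivity
  have hρ₁le : ρ₁ ≤ ρ₀ := div_le_self hρ₀'.le (by linarith [norm_nonneg v])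
  have hvρ : ‖v‖ * ρ₁ ≤ ρ₀ := by
    rw [hρ₁, mul_div_assoc', div_le_iff₀ hv]; nlinarith
  have htv : ∀ t : k, ‖t‖ ≤ ρ₁ → ‖t • v‖ ≤ ρ₀ := by
    intro t ht
    rw [norm_smul]
    calc _ ≤ ρ₁ * ‖v‖ := by gcongr
      _ ≤ _ := by rwa [mul_comm]
  have hcb : ∀ x : E, ‖x‖ ≤ ρ₀ → ∀ n, ‖c x n‖ * ρ₁ ^ n ≤ C := by
    intro x hx n
    refine le_trans ?_ (hC x hx n)
    have : ‖c x n‖ ≤ ‖p.changeOrigin x n‖ * ‖v‖ ^ n := by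
      simpa using (p.changeOrigin x n).le_opNorm (fun _ => v)
    calc _ ≤ ‖p.changeOrigin x n‖ * ‖v‖ ^ n * ρ₁ ^ n := by gcongr
      _ = ‖p.changeOrigin x n‖ * (‖v‖ * ρ₁) ^ n := by rw [mul_pow, mul_assoc]
      _ ≤ _ := by gcongr
  have hc0 : c 0 r = q.coeff r := by
    have h1 : HasFPowerSeriesAt (fun t : k => φ (a + t • v))
        (FormalMultilinearSeries.ofScalars k (c 0)) 0 := by
      rw [hasFPowerSeriesAt_iff]
      filter_upwards [Metric.closedBall_mem_nhds (0 : k) hρ₁0] with t ht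
      have := hsum 0 (by simp) t (htv t (by simpa using ht))
      simpa [mul_comm] using this
    rw [← h1.eq_formalMultilinearSeries hq]
    simp
  intro τ hτ
  have e1 : ∀ᶠ ρ : ℝ in 𝓝[>] 0, ∀ x : E, ‖x‖ ≤ ρ → ‖c x r - c 0 r‖ ≤ τ / 2 := by
    obtain ⟨σ, hσ, h⟩ := Metric.continuousAt_iff.1 hcont (τ / 2) (half_pos hτ)
    filter_upwards [Ioo_mem_nhdsGT hσ] with ρ hρ x hx
    have := h (x := x) (by simpa using hx.trans_lt hρ.2)
    rw [dist_eq_norm] at this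
    exact this.le
  have e2 : ∀ᶠ ρ : ℝ in 𝓝[>] 0, C * (2 / ρ₁) ^ (r + 1) * 2 * ρ ≤ τ / 2 := by
    have : Tendsto (fun ρ : ℝ => C * (2 / ρ₁) ^ (r + 1) * 2 * ρ) (𝓝[>] 0) (𝓝 0) := by
      have : Continuous (fun ρ : ℝ => C * (2 / ρ₁) ^ (r + 1) * 2 * ρ) := by fun_prop
      have := this.tendsto 0
      rw [mul_zero] at this
      exact this.mono_left nhdsWithin_le_nhds
    exact this.eventually_le_const (half_pos hτ)
  filter_upwards [e1, e2, Ioo_mem_nhdsGT (show 0 < ρ₁ / 4 by positivity)]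
    with ρ h1 h2 ⟨h3, h4⟩ x hx s hs hsρ
  have hx0 : ‖x‖ ≤ ρ₀ := by linarith
  have h5 := norm_dividedDifference_sub_coeff_le hs h3 (ρ₀ := ρ₁) (by linarith) hsρ (hcb x hx0)
    (G := fun t => φ (a + x + t • v))
    (fun t ht => hsum x hx0 t (htv t ((hsρ t ht).trans (by linarith))))
  rw [← hc0]
  calc _ = ‖(dividedDifference s (fun t => φ (a + x + t • v)) - c x r) + (c x r - c 0 r)‖ := by
        rw [sub_add_sub_cancel]
    _ ≤ τ / 2 + τ / 2 := (norm_add_le _ _).trans (add_le_add (h5.trans h2) (h1 x hx))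
    _ = τ := add_halves τ

/-- Some line through `a` detects the order of a power series. -/
theorem HasPowerSeriesExpansionAt.exists_line [CompleteSpace k] {d : ℕ} {g : (Fin d → k) → k}
    {a : Fin d → k}
    {c : MvPowerSeries (Fin d) k} (hg : HasPowerSeriesExpansionAt g a c) {r : ℕ}
    (hr : c.order = r) :
    ∃ (v : Fin d → k) (q : FormalMultilinearSeries k k k),
      HasFPowerSeriesAt (fun t : k => g (a + t • v)) q 0 ∧ q.coeff r ≠ 0 := by
  classical
  set S : ℕ → Finset (Fin d →₀ ℕ) := fun n => Finset.finsuppAntidiag Finset.univ n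
  have hS : ∀ n (β : Fin d →₀ ℕ), β ∈ S n ↔ β.degree = n := by
    intro n β
    simp [S, Finset.mem_finsuppAntidiag, Finsupp.degree_eq_sum]
  set P : MvPolynomial (Fin d) k :=
    ∑ β ∈ S r, MvPolynomial.monomial β (MvPowerSeries.coeff β c) with hP
  have hP0 : P ≠ 0 := by
    obtain ⟨β, hβ, hβr⟩ := MvPowerSeries.exists_coeff_ne_zero_and_order (f := c) (by rw [hr]; simp)
    have hβr' : β.degree = r := by rw [hr] at hβr; exact_mod_cast hβr
    intro h
    apply hβ
    have := congrArg (MvPolynomial.coeff β) h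
    simpa [hP, MvPolynomial.coeff_sum, MvPolynomial.coeff_monomial, hS, hβr'] using this
  -- The lowest homogeneous part is a nonzero polynomial over an infinite field. Its value at `v` is
  -- the `r`-th coefficient on the line.
  obtain ⟨v, hv⟩ : ∃ v, MvPolynomial.eval v P ≠ 0 := by
    by_contra! h
    exact hP0 (MvPolynomial.funext fun v => by simpa using h v)
  set b : ℕ → k := fun n => ∑ β ∈ S n, MvPowerSeries.coeff β c * ∏ i, v i ^ β i with hb
  refine ⟨v, FormalMultilinearSeries.ofScalars k b, ?_, ?_⟩
  · rw [hasFPowerSeriesAt_iff]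
    have ht : Tendsto (fun t : k => t • v) (𝓝 0) (𝓝 0) := by
      have : Continuous (fun t : k => t • v) := by fun_prop
      simpa using this.tendsto 0
    filter_upwards [ht.eventually hg] with t ht
    have h1 := ht.tsum_fiberwise (fun β => β.degree)
    simp only [zero_add, FormalMultilinearSeries.coeff_ofScalars, smul_eq_mul]
    convert h1 using 2 with n
    have hfib : (fun β : Fin d →₀ ℕ => β.degree) ⁻¹' {n} = ↑(S n) := by
      ext β; simp [hS]
    rw [hfib, Finset.tsum_subtype' (S n) (fun β => MvPowerSeries.coeff β c * ∏ i, (t • v) i ^ β i),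
      hb, Finset.mul_sum]
    refine Finset.sum_congr rfl fun β hβ => ?_
    have : ∏ i, (t • v) i ^ β i = t ^ n * ∏ i, v i ^ β i := by
      simp only [Pi.smul_apply, smul_eq_mul, mul_pow, Finset.prod_mul_distrib]
      rw [Finset.prod_pow_eq_pow_sum, ← (hS n β).1 hβ, Finsupp.degree_eq_sum]
    rw [this]; ring
  · simp only [FormalMultilinearSeries.coeff_ofScalars, hb]
    simpa [hP, MvPolynomial.eval_monomial, Finsupp.prod_fintype] using hv

end DirectionalCoefficient

/-! ### Haar measure of balls, and Fubini -/

section Volume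

variable {k : Type*} [NontriviallyNormedField k] [ProperSpace k] [MeasurableSpace k] [BorelSpace k]

theorem IsRealOrNonarchimedean.exists_addHaar_closedBall_le (hk : IsRealOrNonarchimedean k) :
    ∃ C : ℝ≥0, ∀ (x : k) (δ : ℝ), 0 < δ → δ ≤ 1 →
      (Measure.addHaar : Measure k) (Metric.closedBall x δ) ≤ C * ENNReal.ofReal δ := by
  set μ : Measure k := Measure.addHaar with hμ
  have htr : ∀ (x : k) (δ : ℝ), μ (Metric.closedBall x δ) = μ (Metric.closedBall 0 δ) := by
    intro x δ
    rw [← measure_preimage_add μ x (Metric.closedBall x δ)]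
    congr 1; ext y; simp
  have hfin : ∀ δ : ℝ, μ (Metric.closedBall 0 δ) ≠ ⊤ := fun δ =>
    (isCompact_closedBall 0 δ).measure_lt_top.ne
  rcases hk with ⟨e, he⟩ | ⟨_, h⟩
  · have hiso : Isometry e := AddMonoidHomClass.isometry_of_norm e he
    let e' : k ≃ᵢ ℝ := ⟨e.toEquiv, hiso⟩
    have hmap : (μ.map e.toAddEquiv).IsAddHaarMeasure :=
      e.toAddEquiv.isAddHaarMeasure_map μ e'.continuous e'.symm.continuous
    have hsm := Measure.isAddLeftInvariant_eq_smul (μ.map e.toAddEquiv) (volume : Measure ℝ)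
    set c := Measure.addHaarScalarFactor (μ.map e.toAddEquiv) (volume : Measure ℝ)
    refine ⟨c * 2, fun x δ hδ _ => ?_⟩
    have h1 : μ (Metric.closedBall x δ) = (μ.map e.toAddEquiv) (Metric.closedBall (e x) δ) := by
      have hm : Measurable e.toAddEquiv := e'.continuous.measurable
      rw [Measure.map_apply hm Metric.isClosed_closedBall.measurableSet]
      congr 1; ext y
      simp only [Metric.mem_closedBall, mem_preimage]
      exact (hiso.dist_eq y x).symm ▸ Iff.rfl
    rw [h1, hsm]
    simp only [Measure.smul_apply, Real.volume_closedBall]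
    rw [ENNReal.ofReal_mul (by norm_num), ENNReal.smul_def, smul_eq_mul, ENNReal.coe_mul, mul_assoc]
    simp
  · refine ⟨(μ (Metric.closedBall 0 1)).toNNReal, fun x δ hδ hδ1 => ?_⟩
    -- `δ` need not be the norm of an element. An element of largest norm in the ball replaces it
    -- without changing the ball.
    obtain ⟨a, ha, hmax⟩ := (isCompact_closedBall (0 : k) δ).exists_isMaxOn
      ⟨0, by simpa using hδ.le⟩ continuous_norm.continuousOn
    have ha' : ‖a‖ ≤ δ := by simpa using ha
    rw [htr, ENNReal.coe_toNNReal (hfin 1), mul_comm]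
    calc μ (Metric.closedBall 0 δ) ≤ μ (Metric.closedBall 0 ‖a‖) := by
          refine measure_mono fun y hy => ?_
          simpa using hmax hy
      _ ≤ ENNReal.ofReal ‖a‖ * μ (Metric.closedBall 0 1) := h a (ha'.trans hδ1)
      _ ≤ _ := by gcongr

/-- A bound for the measure of a set from bounds for its slices in the direction `v`. -/
theorem addHaar_mul_le_of_slices {E : Type*} [NormedAddCommGroup E] [NormedSpace k E]
    [MeasurableSpace E] [BorelSpace E] [SecondCountableTopology E] (μ : Measure E) [SFinite μ]
    [μ.IsAddRightInvariant] (lam : Measure k) [SFinite lam]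
    {A Q : Set E} {B : Set k} (hA : MeasurableSet A) (hB : MeasurableSet B) (hQ : MeasurableSet Q)
    (v : E) (hAQ : ∀ x t, t ∈ B → x + t • v ∈ A → x ∈ Q) {b : ℝ≥0∞}
    (hb : ∀ x ∈ Q, lam {t ∈ B | x + t • v ∈ A} ≤ b) :
    μ A * lam B ≤ b * μ Q := by
  -- For fixed `t ∈ B` the slice of `T` is a translate of `A`; for fixed `x` it is the slice bounded
  -- by `b`. No change of coordinates is needed, and `v = 0` is allowed.
  set T : Set (E × k) := {z | z.2 ∈ B ∧ z.1 + z.2 • v ∈ A} with hT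
  have hTm : MeasurableSet T := by
    refine (measurable_snd hB).inter ?_
    have : Continuous fun z : E × k => z.1 + z.2 • v := by fun_prop
    exact this.measurable hA
  have h1 : (μ.prod lam) T = μ A * lam B := by
    rw [Measure.prod_apply_symm hTm]
    have : ∀ t, μ ((fun x => (x, t)) ⁻¹' T) = B.indicator (fun _ => μ A) t := by
      intro t
      by_cases ht : t ∈ B
      · simp only [hT, preimage_ofPred_eq, ht, true_and, indicator_of_mem]
        exact measure_preimage_add_right μ (t • v) A
      · simp [hT, ht]
    simp_rw [this]
    rw [lintegral_indicator hB, setLIntegral_const]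
  rw [← h1, Measure.prod_apply hTm]
  calc ∫⁻ x, lam (Prod.mk x ⁻¹' T) ∂μ ≤ ∫⁻ x, Q.indicator (fun _ => b) x ∂μ := by
        refine lintegral_mono fun x => ?_
        by_cases hx : x ∈ Q
        · rw [indicator_of_mem hx]; exact hb x hx
        · rw [indicator_of_notMem hx, nonpos_iff_eq_zero]
          have : Prod.mk x ⁻¹' T = ∅ := by
            ext t
            simp only [hT, mem_preimage, mem_ofPred_eq, mem_empty_iff_false, iff_false]
            exact fun h => hx (hAQ x t h.1 h.2)
          rw [this, measure_empty]
    _ = b * μ Q := by rw [lintegral_indicator hQ, setLIntegral_const]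

end Volume

/-! ### Sublevel sets on a line, and uniform lower bounds -/

/-- If the divided differences of order `r ≤ N` of `G` are at least `c` in norm, sublevel sets of
`G` are small. -/
theorem measure_sublevel_le_of_dividedDifference {k : Type*} [NontriviallyNormedField k]
    [MeasurableSpace k] {C : ℝ≥0} {lam : Measure k}
    (hlam : ∀ (x : k) (δ : ℝ), 0 < δ → δ ≤ 1 →
      lam (Metric.closedBall x δ) ≤ C * ENNReal.ofReal δ)
    {r N : ℕ} (hN : 0 < N) (hr : r ≤ N) {G : k → k} {B : Set k} {c : ℝ} (hc : 0 < c)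
    (hG : ∀ s : Finset k, s.card = r + 1 → ↑s ⊆ B → c ≤ ‖dividedDifference s G‖)
    {ε : ℝ} (hε : 0 < ε) (hε1 : 2 * (N + 1) / c * ε ≤ 1) :
    lam {t ∈ B | ‖G t‖ < ε} ≤
      ENNReal.ofReal (N * C * (2 * (N + 1) / c) ^ (1 / N : ℝ) * ε ^ (1 / N : ℝ)) := by
  -- With `δ ^ N = K * ε`, separated points would give `2 * (N + 1) * ε ≤ (r + 1) * ε`, which is
  -- absurd. Since `δ ≤ 1`, `δ ^ r ≥ δ ^ N`.
  set K : ℝ := 2 * (N + 1) / c with hK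
  have hK0 : 0 < K := by positivity
  set δ : ℝ := (K * ε) ^ (1 / N : ℝ) with hδ
  have hKε : 0 < K * ε := by positivity
  have hδ0 : 0 < δ := Real.rpow_pos_of_pos hKε _
  have hδ1 : δ ≤ 1 := Real.rpow_le_one hKε.le hε1 (by positivity)
  have hδN : δ ^ N = K * ε := by
    rw [hδ, one_div, Real.rpow_inv_natCast_pow hKε.le hN.ne']
  rcases exists_separated_or_covered {t ∈ B | ‖G t‖ < ε} hδ0.le r with
    ⟨s, hs, hcard, hsep⟩ | ⟨s, hcard, hs⟩
  · exfalso
    have h1 := norm_dividedDifference_mul_le hcard hδ0 (fun t ht u hu h => (hsep t ht u hu h).le)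
      (fun t ht => (hs ht).2.le)
    have h2 := hG s hcard (fun t ht => (hs ht).1)
    have h3 : K * ε ≤ δ ^ r := hδN ▸ pow_le_pow_of_le_one hδ0.le hδ1 hr
    have h4 : c * (K * ε) ≤ (r + 1) * ε :=
      (mul_le_mul h2 h3 hKε.le (norm_nonneg _)).trans h1
    have h5 : c * (K * ε) = 2 * (N + 1) * ε := by rw [hK]; field_simp
    have h6 : (r : ℝ) ≤ N := by exact_mod_cast hr
    nlinarith
  · calc lam {t ∈ B | ‖G t‖ < ε} ≤ lam (⋃ t ∈ s, Metric.closedBall t δ) := measure_mono hs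
      _ ≤ ∑ t ∈ s, lam (Metric.closedBall t δ) := measure_biUnion_finset_le _ _
      _ ≤ ∑ _t ∈ s, C * ENNReal.ofReal δ := Finset.sum_le_sum fun t _ => hlam t δ hδ0 hδ1
      _ ≤ N * (C * ENNReal.ofReal δ) := by
        rw [Finset.sum_const, nsmul_eq_mul]
        gcongr
        exact hcard.trans hr
      _ = _ := by
        rw [mul_assoc _ (K ^ _), ← Real.mul_rpow hK0.le hε.le, ← hδ, mul_assoc,
          ENNReal.ofReal_mul (by positivity), ENNReal.ofReal_mul (by positivity)]
        simp

/-- A lower bound for the divided differences in a direction `v` which holds for all functions in a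
neighbourhood of `f₀` in a finite-dimensional space. -/
theorem exists_le_norm_dividedDifference {k : Type*} [NontriviallyNormedField k] [CompleteSpace k]
    {E : Type*} [NormedAddCommGroup E] [NormedSpace k E]
    {V : Type*} [NormedAddCommGroup V] [NormedSpace k V] [FiniteDimensional k V]
    (Φ : V →ₗ[k] (E → k)) {a : E} (hΦ : ∀ f, AnalyticAt k (Φ f) a) {f₀ : V} {v : E}
    {q : FormalMultilinearSeries k k k}
    (hq : HasFPowerSeriesAt (fun t : k => Φ f₀ (a + t • v)) q 0) {r : ℕ} (hr : q.coeff r ≠ 0) :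
    ∃ c : ℝ, 0 < c ∧ ∃ W ∈ 𝓝 f₀, ∀ᶠ ρ : ℝ in 𝓝[>] 0, ∀ f ∈ W, ∀ x : E, ‖x‖ ≤ ρ →
      ∀ s : Finset k, s.card = r + 1 → (∀ t ∈ s, ‖t‖ ≤ ρ) →
        c ≤ ‖dividedDifference s (fun t => Φ f (a + x + t • v))‖ := by
  let b := Module.finBasis k V
  have hline : ∀ f, AnalyticAt k (fun t : k => Φ f (a + t • v)) 0 := by
    intro f
    have h1 : AnalyticAt k (fun t : k => a + t • v) 0 := by fun_prop
    have h2 : AnalyticAt k (Φ f) (a + (0 : k) • v) := by simpa using hΦ f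
    exact h2.comp_of_eq h1 rfl
  choose Q hQ using hline
  have hsum : ∀ f, Φ f = ∑ j, b.repr f j • Φ (b j) := by
    intro f
    calc Φ f = Φ (∑ j, b.repr f j • b j) := by rw [b.sum_repr]
      _ = _ := by simp only [map_sum, map_smul]
  -- The `r`-th coefficient on the line as a function of `f`, continuous because `V` is
  -- finite-dimensional.
  set L : V → k := fun f => ∑ j, b.repr f j * (Q (b j)).coeff r with hL
  have hcoord : ∀ j, Continuous fun f => b.repr f j := fun j =>
    (b.coord j).continuous_of_finiteDimensional
  have hLc : Continuous L := continuous_finsetSum _ fun j _ => (hcoord j).mul continuous_const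
  have hL0 : L f₀ = q.coeff r := by
    have h1 : HasFPowerSeriesAt (fun t : k => Φ f₀ (a + t • v))
        (FormalMultilinearSeries.ofScalars k
          (fun n => ∑ j, b.repr f₀ j * (Q (b j)).coeff n)) 0 := by
      rw [hasFPowerSeriesAt_iff]
      have := eventually_all.2 fun j => hasFPowerSeriesAt_iff.1 (hQ (b j))
      filter_upwards [this] with t ht
      have h2 := hasSum_sum (s := Finset.univ) fun j _ => (ht j).mul_left (b.repr f₀ j)
      have h3 : Φ f₀ (a + (0 + t) • v) = ∑ j, b.repr f₀ j * Φ (b j) (a + (0 + t) • v) := by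
        rw [hsum f₀]; simp
      rw [h3]
      refine h2.congr_fun fun n => ?_
      simp only [FormalMultilinearSeries.coeff_ofScalars, smul_eq_mul, Finset.mul_sum]
      exact Finset.sum_congr rfl fun j _ => by ring
    rw [← h1.eq_formalMultilinearSeries hq]
    simp [hL]
  have hL0' : 0 < ‖L f₀‖ := by rw [hL0]; exact norm_pos_iff.2 hr
  set S : ℝ := ∑ j, ‖b.repr f₀ j‖ + 1 with hS
  have hS0 : 0 < S := by positivity
  set τ : ℝ := ‖L f₀‖ / (4 * S) with hτ
  have hτ0 : 0 < τ := by positivity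
  -- Half of `‖L f₀‖` survives near `f₀`; the errors on the finitely many basis functions add up to
  -- at most `S * τ = ‖L f₀‖ / 4`.
  have hW1 : ∀ᶠ f in 𝓝 f₀, ‖L f₀‖ / 2 < ‖L f‖ :=
    hLc.norm.continuousAt.eventually_const_lt (half_lt_self hL0')
  have hW2 : ∀ᶠ f in 𝓝 f₀, ∑ j, ‖b.repr f j‖ < S :=
    (continuous_finsetSum _ fun j _ => (hcoord j).norm).continuousAt.eventually_lt_const
      (lt_add_one _)
  refine ⟨‖L f₀‖ / 4, by positivity, _, hW1.and hW2, ?_⟩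
  have hdd := eventually_all.2 fun j =>
    (hQ (b j)).hasDirectionalCoeff (hΦ (b j)) (r := r) τ hτ0
  filter_upwards [hdd] with ρ hρ f hf x hx s hs hsρ
  have e1 : dividedDifference s (fun t => Φ f (a + x + t • v)) =
      ∑ j, b.repr f j * dividedDifference s (fun t => Φ (b j) (a + x + t • v)) := by
    simp_rw [← dividedDifference_const_mul, ← dividedDifference_sum]
    congr 1; ext t
    conv_lhs => rw [hsum f]
    simp
  have e2 : ‖dividedDifference s (fun t => Φ f (a + x + t • v)) - L f‖ ≤ ‖L f₀‖ / 4 := by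
    rw [e1, show L f = ∑ j, b.repr f j * (Q (b j)).coeff r from rfl, ← Finset.sum_sub_distrib]
    calc _ ≤ ∑ j, ‖b.repr f j‖ * τ := by
          refine norm_sum_le_of_le _ fun j _ => ?_
          rw [← mul_sub, norm_mul]
          exact mul_le_mul_of_nonneg_left (hρ j x hx s hs hsρ) (norm_nonneg _)
      _ ≤ S * τ := by rw [← Finset.sum_mul]; gcongr; exact hf.2.le
      _ = _ := by rw [hτ]; field_simp
  have e3 := norm_sub_norm_le (L f) (L f - dividedDifference s (fun t => Φ f (a + x + t • v)))
  rw [sub_sub_cancel, norm_sub_rev (L f)] at e3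
  have := hf.1
  linarith

/-! ### The local estimate on the manifold -/

section Manifold

variable {k : Type*} [NontriviallyNormedField k] {d m : ℕ}
  {M : Type*} [TopologicalSpace M] [ChartedSpace (Fin d → k) M]

theorem analyticAt_chart_symm [CompleteSpace k] {f : C(M, Fin m → k)} (hf : f ∈ analyticMaps k d m M)
    (p : M) (i : Fin m) :
    AnalyticAt k (fun y => f ((chartAt (Fin d → k) p).symm y) i)
      (chartAt (Fin d → k) p p) := by
  have h := (contMDiffAt_iff.1 (hf p)).2
  rw [ModelWithCorners.range_eq_univ] at h
  have h1 : ContDiffAt k ω (fun y => f ((chartAt (Fin d → k) p).symm y))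
      (chartAt (Fin d → k) p p) := h
  exact (contDiffAt_pi.1 h1 i).analyticAt

/-- The coordinate `i` in the preferred chart at `p`, as a linear map. -/
def chartCoordinate (p : M) (i : Fin m) (V : Submodule k C(M, Fin m → k)) :
    V →ₗ[k] ((Fin d → k) → k) where
  toFun f y := (f : C(M, Fin m → k)) ((chartAt (Fin d → k) p).symm y) i
  map_add' _ _ := rfl
  map_smul' _ _ := rfl

theorem exists_order_of_mapOrd_le {f : M → (Fin m → k)} {p : M} {N : ℕ}
    (h : mapOrd (d := d) f p ≤ N) :
    ∃ (i : Fin m) (c : MvPowerSeries (Fin d) k) (r : ℕ), r ≤ N ∧ c.order = r ∧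
      HasPowerSeriesExpansionAt ((fun x => f x i) ∘ (chartAt (Fin d → k) p).symm)
        (chartAt (Fin d → k) p p) c := by
  -- A strict bound on the infima yields witnesses for `i` and `c`.
  have h1 : mapOrd (d := d) f p < (N + 1 : ℕ) := h.trans_lt (by exact_mod_cast N.lt_succ_self)
  simp only [mapOrd, scalarOrd, orderAt, iInf_lt_iff] at h1
  obtain ⟨i, c, hc, hlt⟩ := h1
  obtain ⟨r, hr⟩ := ENat.ne_top_iff_exists.1 (ne_top_of_lt hlt)
  rw [← hr] at hlt
  exact ⟨i, c, r, Nat.lt_succ_iff.1 (by exact_mod_cast hlt), hr.symm, hc⟩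

theorem mapOrd_le_familyOrd {F : Set (analyticMaps k d m M)} {f : analyticMaps k d m M}
    (hf : f ∈ F) (p : M) : mapOrd (d := d) (f : C(M, Fin m → k)) p ≤ familyOrd F :=
  le_iSup_of_le p (le_iSup₂_of_le f hf le_rfl)

/-- Order zero means that some component has a nonzero constant coefficient, which is its value at
`p`. -/
theorem apply_ne_zero_of_mapOrd_eq_zero {f : M → (Fin m → k)} {p : M}
    (h : mapOrd (d := d) f p ≤ 0) : f p ≠ 0 := by
  obtain ⟨i, c, r, hr, hc, hexp⟩ := exists_order_of_mapOrd_le (N := 0) (by simpa using h)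
  obtain rfl : r = 0 := by omega
  have h0 := hexp.self_of_nhds
  have hc0 : MvPowerSeries.coeff 0 c ≠ 0 := by
    obtain ⟨β, hβ, hβ0⟩ := MvPowerSeries.exists_coeff_ne_zero_and_order (f := c) (by rw [hc]; simp)
    rw [hc] at hβ0
    have : β = 0 := (Finsupp.degree_eq_zero_iff β).1 (by exact_mod_cast hβ0)
    rwa [this] at hβ
  have h1 : HasSum (fun β : Fin d →₀ ℕ => MvPowerSeries.coeff β c *
      ∏ i, (0 : Fin d → k) i ^ β i) (MvPowerSeries.coeff 0 c) := by
    convert hasSum_single (0 : Fin d →₀ ℕ) fun β hβ => ?_ using 1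
    · simp
    · obtain ⟨j, hj⟩ := Finsupp.ne_iff.1 hβ
      rw [Finset.prod_eq_zero (Finset.mem_univ j), mul_zero]
      simpa using hj
  intro hf
  apply hc0
  rw [h1.unique h0]
  simp [hf]

variable [ProperSpace k] [MeasurableSpace k] [BorelSpace k] [CompactSpace M] [MeasurableSpace M]
  [BorelSpace M]

/-- The estimate for sublevel sets near a point of `M` and near a function of the family. -/
theorem exists_measure_sublevel_le_nhds (hk : IsRealOrNonarchimedean k) {η : Measure M}
    (hη : HasLocallyBoundedDensity k d η) (V : Submodule k C(M, Fin m → k))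
    [FiniteDimensional k V] (hV : V ≤ analyticMaps k d m M) {N : ℕ} (hN : 0 < N) (f₀ : V) (p : M)
    (hord : mapOrd (d := d) (f₀ : C(M, Fin m → k)) p ≤ N) :
    ∃ W ∈ 𝓝 f₀, ∃ U ∈ 𝓝 p, ∃ (κ : ℝ≥0) (ε₀ : ℝ), 0 < ε₀ ∧ ∀ f ∈ W, ∀ ε : ℝ, 0 < ε → ε < ε₀ →
      η (U ∩ {x | ‖(f : C(M, Fin m → k)) x‖ < ε}) ≤
        κ * ENNReal.ofReal (ε ^ (1 / N : ℝ)) := by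
  obtain ⟨i, c, r, hrN, hcr, hexp⟩ := exists_order_of_mapOrd_le hord
  obtain ⟨v, q, hq, hqr⟩ := hexp.exists_line hcr
  set e := chartAt (Fin d → k) p with he
  set a := e p with ha
  obtain ⟨γ, hγ, W, hW, hdd⟩ := exists_le_norm_dividedDifference (chartCoordinate p i V)
    (a := a) (fun f => analyticAt_chart_symm (hV f.2) p i) (f₀ := f₀) hq hqr
  obtain ⟨U, hU, hUe, D, hD⟩ := hη e (chart_mem_atlas _ p) p (mem_chart_source _ p)
  obtain ⟨C, hC⟩ := hk.exists_addHaar_closedBall_le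
  obtain ⟨ρ, hρ, hρ0⟩ := (hdd.and self_mem_nhdsWithin).exists
  set μ : Measure (Fin d → k) := Measure.addHaar
  set lam : Measure k := Measure.addHaar
  -- For `t ∈ B` the shift `t • v` has norm at most `ρ / 2`. As the image of `U'` lies within `ρ /
  -- 2` of `a`, every base point of a relevant line lies in `Q`.
  set ρ' : ℝ := ρ / (2 * (1 + ‖v‖)) with hρ'
  have hv : 0 < 1 + ‖v‖ := by positivity
  have hρ'0 : 0 < ρ' := by positivity
  have hρ'le : ρ' ≤ ρ := div_le_self hρ0.le (by linarith [norm_nonneg v])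
  have hρ'v : ρ' * ‖v‖ ≤ ρ / 2 := by
    rw [hρ', div_mul_eq_mul_div, div_le_div_iff₀ (by positivity) (by positivity)]
    nlinarith
  set B : Set k := Metric.closedBall 0 ρ' with hB
  set Q : Set (Fin d → k) := Metric.closedBall a ρ with hQ
  have hB0 : lam B ≠ 0 := (Metric.measure_closedBall_pos lam _ hρ'0).ne'
  have hBt : lam B ≠ ⊤ := (isCompact_closedBall _ _).measure_lt_top.ne
  have hQt : μ Q ≠ ⊤ := (isCompact_closedBall _ _).measure_lt_top.ne
  set U' : Set M := interior U ∩ (e.source ∩ e ⁻¹' Metric.ball a (ρ / 2)) with hU'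
  have hU'o : IsOpen U' :=
    isOpen_interior.inter (e.isOpen_inter_preimage Metric.isOpen_ball)
  have hpU' : p ∈ U' :=
    ⟨mem_interior_iff_mem_nhds.2 hU, mem_chart_source _ p, by simpa [ha] using half_pos hρ0⟩
  set K : ℝ := 2 * (N + 1) / γ with hK
  have hK0 : 0 < K := by positivity
  set c' : ℝ := N * C * K ^ (1 / N : ℝ) with hc'
  have hc'0 : 0 ≤ c' := by positivity
  refine ⟨W, hW, U', hU'o.mem_nhds hpU',
    (D * (ENNReal.ofReal c' * μ Q / lam B)).toNNReal, 1 / K, by positivity, ?_⟩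
  intro f hf ε hε hε0
  rw [ENNReal.coe_toNNReal (by finiteness)]
  set g : M → k := fun x => (f : C(M, Fin m → k)) x i with hg
  have hgc : Continuous g :=
    (continuous_apply i).comp (f : C(M, Fin m → k)).continuous
  -- Passing to the single component `i` only enlarges the sublevel set.
  set s : Set M := U' ∩ {x | ‖g x‖ < ε} with hs
  have hso : IsOpen s := hU'o.inter (isOpen_lt hgc.norm continuous_const)
  have hse : s ⊆ e.source := fun x hx => hx.1.2.1
  have hA : IsOpen (e '' s) := e.isOpen_image_of_subset_source hso hse
  have hslice : μ (e '' s) * lam B ≤ ENNReal.ofReal (c' * ε ^ (1 / N : ℝ)) * μ Q := by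
    refine addHaar_mul_le_of_slices μ lam hA.measurableSet Metric.isClosed_closedBall.measurableSet
      Metric.isClosed_closedBall.measurableSet v ?_ ?_
    · rintro x t ht ⟨y, hy, hyx⟩
      have h1 : ‖e y - a‖ < ρ / 2 := by simpa [dist_eq_norm] using hy.1.2.2
      have h2 : ‖t • v‖ ≤ ρ / 2 := by
        rw [norm_smul]
        refine le_trans ?_ hρ'v
        gcongr; simpa [hB] using ht
      rw [Metric.mem_closedBall, dist_eq_norm]
      have : x - a = (e y - a) - t • v := by rw [hyx]; abel
      rw [this]
      linarith [norm_sub_le (e y - a) (t • v)]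
    · intro x hx
      have hx' : ‖x - a‖ ≤ ρ := by simpa [hQ, dist_eq_norm] using hx
      refine (measure_mono ?_).trans (measure_sublevel_le_of_dividedDifference hC hN hrN
        (G := fun t => chartCoordinate p i V f (a + (x - a) + t • v)) (B := B) hγ ?_ hε ?_)
      · rintro t ⟨ht, y, hy, hyx⟩
        refine ⟨ht, ?_⟩
        have : e.symm (a + (x - a) + t • v) = y := by
          rw [add_sub_cancel, ← hyx, e.left_inv (hse hy)]
        change ‖g (e.symm (a + (x - a) + t • v))‖ < ε
        rw [this]; exact hy.2
      · intro s' hs' hsB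
        refine hρ f hf (x - a) hx' s' hs' fun t ht => ?_
        have : ‖t‖ ≤ ρ' := by simpa [hB] using hsB ht
        exact this.trans hρ'le
      · rw [mul_comm]; exact ((lt_div_iff₀ hK0).1 hε0).le
  calc η (U' ∩ {x | ‖(f : C(M, Fin m → k)) x‖ < ε}) ≤ η s := by
        refine measure_mono (inter_subset_inter_right _ fun x hx => ?_)
        exact (norm_le_pi_norm _ i).trans_lt hx
    _ ≤ D * μ (e '' s) :=
        hD s (fun x hx => interior_subset hx.1.1) hso.measurableSet
    _ ≤ D * (ENNReal.ofReal (c' * ε ^ (1 / N : ℝ)) * μ Q / lam B) := by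
        gcongr
        rwa [ENNReal.le_div_iff_mul_le (.inl hB0) (.inl hBt)]
    _ = _ := by
        rw [ENNReal.ofReal_mul hc'0]
        simp only [div_eq_mul_inv]
        ring

end Manifold

/-! ### Globalization by compactness -/

theorem mainTheorem9 {k : Type*} [NontriviallyNormedField k] [ProperSpace k]
    [MeasurableSpace k] [BorelSpace k] (hk : IsRealOrNonarchimedean k)
    {d m : ℕ} (hd : 1 ≤ d)
    {M : Type*} [TopologicalSpace M] [T2Space M] [CompactSpace M]
    [ChartedSpace (Fin d → k) M] [IsManifold 𝓘(k, Fin d → k) ω M]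
    [MeasurableSpace M] [BorelSpace M]
    (η : Measure M) [IsProbabilityMeasure η]
    (hη : InCanonicalMeasureClass k d η) (hη' : HasLocallyBoundedDensity k d η)
    (F : Set (analyticMaps k d m M)) (hF : IsCompact F)
    (hspan : Module.Finite k (Submodule.span k F)) :
    ∃ κ ε₀ : ℝ, 0 < κ ∧ 0 < ε₀ ∧
      ∀ f ∈ F, ∀ ε : ℝ, 0 < ε → ε < ε₀ →
        η {x : M | ‖(f : C(M, Fin m → k)) x‖ < ε} ≤
          ENNReal.ofReal κ *
            extendedPow ε (1 / (((d : ℕ∞) * familyOrd F : ℕ∞) : ℝ≥0∞)) := by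
  have hdN : (d : ℕ∞) ≠ 0 := by exact_mod_cast (by omega : d ≠ 0)
  rcases eq_or_ne (familyOrd F) ⊤ with htop | htop
  · refine ⟨1, 1, one_pos, one_pos, fun f _ ε _ _ => ?_⟩
    rw [htop, ENat.mul_top hdN]
    simpa [extendedPow] using prob_le_one
  rcases eq_or_ne (familyOrd F) 0 with hzero | hzero
  -- Exponent `∞`: no `f ∈ F` has a zero, so the norm has a positive minimum on `F × M` and small
  -- sublevel sets are empty.
  · have := isCompact_iff_compactSpace.1 hF
    set G : F × M → ℝ := fun z => ‖((z.1 : analyticMaps k d m M) : C(M, Fin m → k)) z.2‖ with hG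
    have hGc : Continuous G := by
      refine continuous_norm.comp (Continuous.eval ?_ continuous_snd)
      exact continuous_subtype_val.comp (continuous_subtype_val.comp continuous_fst)
    have hG0 : ∀ z, 0 < G z := fun z => norm_pos_iff.2 (apply_ne_zero_of_mapOrd_eq_zero
      (hzero ▸ mapOrd_le_familyOrd z.1.2 z.2))
    obtain ⟨ε₀, hε₀, h⟩ : ∃ ε₀ : ℝ, 0 < ε₀ ∧ ∀ z, ε₀ ≤ G z := by
      rcases isEmpty_or_nonempty (F × M) with hE | hE
      · exact ⟨1, one_pos, fun z => hE.elim z⟩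
      · obtain ⟨z, -, hz⟩ := isCompact_univ.exists_isMinOn univ_nonempty hGc.continuousOn
        exact ⟨G z, hG0 z, fun w => hz (mem_univ w)⟩
    refine ⟨1, ε₀, one_pos, hε₀, fun f hf ε _ hε => ?_⟩
    have : {x : M | ‖(f : C(M, Fin m → k)) x‖ < ε} = ∅ :=
      eq_empty_of_forall_notMem fun x hx => (hε.trans_le (h (⟨f, hf⟩, x))).not_gt hx
    rw [this, measure_empty]
    exact zero_le
  obtain ⟨R, hR⟩ := ENat.ne_top_iff_exists.1 htop
  have hR0 : R ≠ 0 := by rintro rfl; exact hzero (by simpa using hR.symm)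
  set N : ℕ := d * R with hN
  have hN0 : 0 < N := Nat.mul_pos hd (Nat.pos_of_ne_zero hR0)
  have hRN : R ≤ N := Nat.le_mul_of_pos_left R hd
  have hpow : ∀ ε : ℝ, extendedPow ε (1 / (((d : ℕ∞) * familyOrd F : ℕ∞) : ℝ≥0∞)) =
      ENNReal.ofReal (ε ^ (1 / N : ℝ)) := by
    intro ε
    have h1 : ((((d : ℕ∞) * familyOrd F : ℕ∞)) : ℝ≥0∞) = (N : ℝ≥0∞) := by
      rw [← hR, hN]; simp
    have h2 : (1 / (N : ℝ≥0∞)) ≠ ⊤ := by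
      simpa using hN0.ne'
    rw [h1, extendedPow, if_neg h2]
    simp
  set V : Submodule k C(M, Fin m → k) :=
    (Submodule.span k F).map (analyticMaps k d m M).subtype with hVdef
  have hVfin : FiniteDimensional k V := Module.Finite.map _ _
  have hV : V ≤ analyticMaps k d m M := Submodule.map_subtype_le _ _
  let j : F → V := fun f => ⟨((f : analyticMaps k d m M) : C(M, Fin m → k)),
    Submodule.mem_map_of_mem (Submodule.subset_span f.2)⟩
  have hj : Continuous j :=
    (continuous_subtype_val.comp continuous_subtype_val).subtype_mk _
  have := isCompact_iff_compactSpace.1 hF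
  -- Neighbourhoods in the product `F × M` let one finite subcover make the constants uniform in `f`
  -- and `x` together.
  have hloc : ∀ z : F × M, ∃ O ∈ 𝓝 z, ∃ (κ : ℝ≥0) (ε₀ : ℝ), 0 < ε₀ ∧
      ∀ f : F, ∀ ε : ℝ, 0 < ε → ε < ε₀ →
        η {x | (f, x) ∈ O ∧ ‖((f : analyticMaps k d m M) : C(M, Fin m → k)) x‖ < ε} ≤
          κ * ENNReal.ofReal (ε ^ (1 / N : ℝ)) := by
    rintro ⟨f₀, p⟩
    obtain ⟨W, hW, U, hU, κ, ε₀, hε₀, h⟩ := exists_measure_sublevel_le_nhds hk hη' V hV hN0 (j f₀) p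
      ((mapOrd_le_familyOrd f₀.2 p).trans (by rw [← hR]; exact_mod_cast hRN))
    refine ⟨(j ⁻¹' W) ×ˢ U, prod_mem_nhds (hj.continuousAt hW) hU, κ, ε₀, hε₀, ?_⟩
    intro f ε hε hε'
    by_cases hf : j f ∈ W
    · refine (measure_mono ?_).trans (h (j f) hf ε hε hε')
      exact fun x hx => ⟨hx.1.2, hx.2⟩
    · have : {x | (f, x) ∈ (j ⁻¹' W) ×ˢ U ∧
          ‖((f : analyticMaps k d m M) : C(M, Fin m → k)) x‖ < ε} = ∅ :=
        eq_empty_of_forall_notMem fun x hx => hf hx.1.1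
      rw [this, measure_empty]
      exact zero_le
  choose O hO κ ε₀ hε₀ hbound using hloc
  obtain ⟨T, hT⟩ := CompactSpace.elim_nhds_subcover O hO
  obtain ⟨ε₁, hε₁, hε₁T⟩ : ∃ ε₁ : ℝ, 0 < ε₁ ∧ ∀ z ∈ T, ε₁ ≤ ε₀ z := by
    rcases T.eq_empty_or_nonempty with rfl | hTn
    · exact ⟨1, one_pos, by simp⟩
    · obtain ⟨z, hz, hmin⟩ := T.exists_min_image ε₀ hTn
      exact ⟨ε₀ z, hε₀ z, hmin⟩
  -- The `+ 1` only ensures positivity.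
  refine ⟨∑ z ∈ T, (κ z : ℝ) + 1, ε₁, by positivity, hε₁, fun f hf ε hε hε' => ?_⟩
  rw [hpow]
  calc η {x : M | ‖(f : C(M, Fin m → k)) x‖ < ε}
      ≤ η (⋃ z ∈ T, {x | ((⟨f, hf⟩ : F), x) ∈ O z ∧ ‖(f : C(M, Fin m → k)) x‖ < ε}) := by
        refine measure_mono fun x hx => ?_
        have : ((⟨f, hf⟩ : F), x) ∈ ⋃ z ∈ T, O z := hT ▸ mem_univ _
        obtain ⟨z, hz, hxz⟩ := mem_iUnion₂.1 this
        exact mem_iUnion₂.2 ⟨z, hz, hxz, hx⟩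
    _ ≤ ∑ z ∈ T, η {x | ((⟨f, hf⟩ : F), x) ∈ O z ∧ ‖(f : C(M, Fin m → k)) x‖ < ε} :=
        measure_biUnion_finset_le _ _
    _ ≤ ∑ z ∈ T, (κ z : ℝ≥0∞) * ENNReal.ofReal (ε ^ (1 / N : ℝ)) :=
        Finset.sum_le_sum fun z hz => hbound z ⟨f, hf⟩ ε hε (hε'.trans_le (hε₁T z hz))
    _ ≤ _ := by
        rw [← Finset.sum_mul]
        gcongr
        have h1 : ∑ z ∈ T, (κ z : ℝ≥0∞) = ENNReal.ofReal (∑ z ∈ T, (κ z : ℝ)) := by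
          rw [ENNReal.ofReal_sum_of_nonneg fun _ _ => NNReal.coe_nonneg _]; simp
        rw [h1]
        exact ENNReal.ofReal_le_ofReal (le_add_of_nonneg_right zero_le_one)
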